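/- Let $\mathbb{F}_q$ be the finite field with $q = 2^m \ge 8$ elements, enumerated as $\mathbb{F}_q = \{\alpha_1, \dots, \alpha_q\}$, let $\theta \in \mathbb{F}_q$ with $\theta \ne 0$, and let $k$ be an integer with $\frac{3q-4}{4} \le k \le q-4$. Let $$\mathcal{S}_{k,\theta} = \Big\{ \sum_{i=0}^{k-2} f_i x^i + f_{k-1}\,(x^{k-1} + \theta x^k) : f_0, \dots, f_{k-1} \in \mathbb{F}_q \Big\},$$ write $u_f = (f(\alpha_1), \dots, f(\alpha_q))$ for a polynomial $f \in \mathbb{F}_q[x]$, and let $\mathrm{TRS}_k(\mathbb{F}_q, \theta) = \{ u_f : f \in \mathcal{S}_{k,\theta} \} \subseteq \mathbb{F}_q^q$ be the full-length twisted Reed--Solomon code. The error distance of $u \in \mathbb{F}_q^q$ to a linear code $C \subseteq \mathbb{F}_q^q$ is $d(u, C) = \min_{c \in C} d(u, c)$, where $d$ is the Hamming distance; the covering radius of $C$ is $\rho(C) = \max_{v \in \mathbb{F}_q^q} d(v, C)$; and $u$ is a deep hole of $C$ if $d(u, C) = \rho(C)$. Then a vector $u \in \mathbb{F}_q^q$ is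 a deep hole of $\mathrm{TRS}_k(\mathbb{F}_q, \theta)$ if and only if $u = u_f$ for some polynomial $f(x) = a x^k + f_{k,\theta}(x)$ with $a \in \mathbb{F}_q$, $a \neq 0$, and $f_{k,\theta} \in \mathcal{S}_{k,\theta}$. -/

import Mathlib

open Polynomial

/-- The error distance `d(u, C) = min_{c ∈ C} d(u, c)` of a vector `u` to a linear code `C`
(the minimum is over a nonempty set, since `0 ∈ C`). -/
noncomputable def errorDist {ι F : Type*} [Fintype ι] [DecidableEq F] [Field F]
    (C : Submodule F (ι → F)) (u : ι → F) : ℕ :=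
  sInf {d : ℕ | ∃ c ∈ C, d = hammingDist u c}

theorem errorDist_le_card {ι F : Type*} [Fintype ι] [DecidableEq F] [Field F]
    (C : Submodule F (ι → F)) (u : ι → F) : errorDist C u ≤ Fintype.card ι := by
  have h : errorDist C u ≤ hammingDist u 0 := Nat.sInf_le ⟨0, C.zero_mem, rfl⟩
  exact h.trans hammingDist_le_card_fintype

/-- The covering radius `ρ(C) = max_u d(u, C)` of a linear code `C`. -/
noncomputable def coveringRadius {ι F : Type*} [Fintype ι] [DecidableEq F] [Field F]
    (C : Submodule F (ι → F)) : ℕ :=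
  sSup (Set.range (errorDist C))

/-- The supremum defining the covering radius is a maximum. -/
theorem isGreatest_coveringRadius {ι F : Type*} [Fintype ι] [DecidableEq F] [Field F]
    (C : Submodule F (ι → F)) :
    IsGreatest (Set.range (errorDist C)) (coveringRadius C) := by
  have hb : BddAbove (Set.range (errorDist C)) :=
    ⟨Fintype.card ι, by rintro _ ⟨u, rfl⟩; exact errorDist_le_card C u⟩
  exact ⟨Nat.sSup_mem ⟨_, 0, rfl⟩ hb, fun _ hx => le_csSup hb hx⟩

/-- A deep hole of a linear code is a vector whose error distance is the covering radius. -/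
def IsDeepHole {ι F : Type*} [Fintype ι] [DecidableEq F] [Field F]
    (C : Submodule F (ι → F)) (u : ι → F) : Prop :=
  errorDist C u = coveringRadius C

/-- The space `S_{k,θ}` of twisted polynomials
`∑_{i ≤ k-2} f_i x^i + f_{k-1} (x^{k-1} + θ x^k)`. -/
noncomputable def twistedPolynomials {F : Type*} [Field F] (k : ℕ) (θ : F) :
    Submodule F F[X] where
  carrier := {f | ∃ c : ℕ → F, f = ∑ i ∈ Finset.range (k - 1), C (c i) * X ^ i
    + C (c (k - 1)) * (X ^ (k - 1) + C θ * X ^ k)}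
  zero_mem' := ⟨0, by simp⟩
  add_mem' := by
    rintro _ _ ⟨c, rfl⟩ ⟨d, rfl⟩
    refine ⟨c + d, ?_⟩
    simp only [Pi.add_apply, C_add, add_mul, Finset.sum_add_distrib]
    ring
  smul_mem' := by
    rintro a _ ⟨c, rfl⟩
    refine ⟨a • c, ?_⟩
    simp only [Pi.smul_apply, smul_eq_mul, C_mul, smul_eq_C_mul, mul_add, Finset.mul_sum,
      mul_assoc]

/-- The evaluation map `f ↦ u_f = (f(α_i))_i`. -/
noncomputable def evalVec {ι F : Type*} [Field F] (α : ι → F) : F[X] →ₗ[F] (ι → F) :=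
  LinearMap.pi fun i => leval (α i)

/-- The twisted Reed-Solomon code with evaluation points `α i`: all vectors `u_f`
with `f ∈ S_{k,θ}`. -/
noncomputable def TRS {ι F : Type*} [Field F] (α : ι → F) (k : ℕ) (θ : F) :
    Submodule F (ι → F) :=
  (twistedPolynomials k θ).map (evalVec α)

/-! Put `N = q - k - 4`, `t = θ⁻¹` and let `s p = ∑ u_i p(α_i)`. By power sums over the field, `s (X
^ i)` is, up to sign, the coefficient of degree `q - 1 - i` of the interpolant of `u`. So `s`
vanishes in degrees `≤ N + 2` exactly when `u` comes from a polynomial of degree `≤ k`, that is,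
from `a x^k + f` with `f` twisted. If `a ≠ 0`, then `u` has the error distance of `x^k`, which is at
least `q - k = N + 4`, because a nonzero polynomial of degree `≤ k` has at most `k` zeros.

It remains to show that every other `u` has error distance at most `N + 3`. If `a = 0` then `u` is a
codeword. Otherwise `s` is nonzero in degrees `≤ N + 2`, and an error supported on a set `B` of `N +
3` points can always be matched to `s` in those degrees. The one remaining parity check, on `X^(N+4)
+ t X^(N+3)`, becomes `s (∏_{b ∈ B} (X + b) * (X + t + ∑ B)) = 0`. Finding such a `B` is the content
of `exists_card_eq_rootPoly`.

Choose `N` points `A` and set `d = t + ∑ A`. Generically the last factors are taken with roots `x, x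
+ d, y, y`: the equation is then linear in `y ^ 2`, and squaring is bijective in characteristic two.
This fails when the coefficient of `y ^ 2` vanishes identically. In that case `A` is placed in an
additive subgroup of index two, the roots are `x, x + c, y, y + c + d`, and an Artin–Schreier
equation is solved for `y`. -/

theorem card_filter_eval_eq_zero_le {F : Type*} [Field F] [Fintype F] [DecidableEq F]
    (p : F[X]) (hp : p ≠ 0) (n : ℕ) (hn : p.natDegree ≤ n) :
    (Finset.univ.filter fun x => p.eval x = 0).card ≤ n := by
  have h : (Finset.univ.filter fun x => p.eval x = 0) ⊆ p.roots.toFinset := by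
    intro x hx
    simpa [hp] using hx
  exact (Finset.card_le_card h).trans
    ((Multiset.toFinset_card_le _).trans ((card_roots' p).trans hn))

/-! ### Artin–Schreier equations and additive subgroups of index two -/

/-- The elements of the form `x ^ 2 + x` in a commutative ring of characteristic two. -/
def artinSchreierRange (F : Type*) [CommRing F] [CharP F 2] : AddSubgroup F where
  carrier := {z | ∃ x, x ^ 2 + x = z}
  zero_mem' := ⟨0, by simp⟩
  add_mem' := by
    rintro _ _ ⟨x, rfl⟩ ⟨y, rfl⟩
    exact ⟨x + y, by rw [CharTwo.add_sq]; ring⟩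
  neg_mem' := by
    rintro _ ⟨x, rfl⟩
    exact ⟨x, by rw [CharTwo.neg_eq]⟩

/-- The additive map `x ↦ x ^ 2 + x` has kernel `{0, 1}`, and the index of its range equals the
order of its kernel. -/
theorem index_artinSchreierRange (F : Type*) [Field F] [Fintype F] [CharP F 2] :
    (artinSchreierRange F).index = 2 := by
  let φ : F →+ F :=
    { toFun := fun x => x ^ 2 + x
      map_zero' := by simp
      map_add' := fun x y => by rw [CharTwo.add_sq]; ring }
  have hr : φ.range = artinSchreierRange F := by
    ext z
    exact Iff.rfl
  have hk : (φ.ker : Set F) = {0, 1} := by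
    ext x
    have : x ^ 2 + x = x * (x + 1) := by ring
    simp [φ, AddMonoidHom.mem_ker, this, CharTwo.add_eq_zero]
  have hc : Nat.card φ.ker = 2 := by
    change Nat.card (φ.ker : Set F) = 2
    rw [hk, Nat.card_coe_set_eq, Set.ncard_pair zero_ne_one]
  have h1 := φ.ker.card_mul_index
  have h2 := (artinSchreierRange F).card_mul_index
  rw [AddSubgroup.index_ker, hr, hc] at h1
  have h3 : 0 < Nat.card (artinSchreierRange F) := Nat.card_pos
  rw [← h1, mul_comm 2] at h2
  exact Nat.eq_of_mul_eq_mul_left h3 h2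

theorem add_mem_artinSchreierRange_iff {F : Type*} [Field F] [Fintype F] [CharP F 2] {x y : F} :
    x + y ∈ artinSchreierRange F ↔ (x ∈ artinSchreierRange F ↔ y ∈ artinSchreierRange F) :=
  AddSubgroup.add_mem_iff_of_index_two (index_artinSchreierRange F)

theorem exists_notMem_artinSchreierRange (F : Type*) [Field F] [Fintype F] [CharP F 2] :
    ∃ z : F, z ∉ artinSchreierRange F := by
  by_contra! h
  have h1 := index_artinSchreierRange F
  rw [(AddSubgroup.eq_top_iff' _).2 h, AddSubgroup.index_top] at h1
  omega

/-- A subset meeting every orbit of translation by `d` contains at least half of the group. -/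
theorem card_le_two_mul_card_of_translate {G : Type*} [AddCommGroup G] [Fintype G] [DecidableEq G]
    (T : Finset G) (d : G) (h : ∀ x, x ∈ T ∨ x + d ∈ T) : Fintype.card G ≤ 2 * T.card := by
  have hs : (Finset.univ : Finset G) ⊆ T ∪ T.image (· - d) := by
    intro x _
    rcases h x with h | h
    · exact Finset.mem_union_left _ h
    · exact Finset.mem_union_right _ (Finset.mem_image.2 ⟨_, h, by simp⟩)
  have h1 := Finset.card_le_card hs
  have h2 := Finset.card_union_le T (T.image (· - d))
  have h3 : (T.image (· - d)).card ≤ T.card := Finset.card_image_le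
  rw [Finset.card_univ] at h1
  omega

/-- Over a large field of characteristic two, four elements with prescribed sum and prescribed
cubic symmetric function can be chosen with three of them off a given half of the field. -/
theorem exists_four_roots_off_hyperplane {F : Type*} [Field F] [Fintype F] [DecidableEq F]
    [CharP F 2] (hq : 16 ≤ Fintype.card F) (h d κ : F) (hd : h * d ∉ artinSchreierRange F) :
    ∃ c x y : F, h * x ∉ artinSchreierRange F ∧ h * (x + c) ∉ artinSchreierRange F ∧
      h * y ∉ artinSchreierRange F ∧ c ≠ 0 ∧ y ≠ x ∧ y ≠ x + c ∧
      κ + d * c * (c + d) + c * (x ^ 2 + c * x) + (c + d) * (y ^ 2 + (c + d) * y) = 0 := by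
  classical
  set R := artinSchreierRange F with hR
  have radd : ∀ x y : F, x + y ∈ R ↔ (x ∈ R ↔ y ∈ R) := fun x y =>
    add_mem_artinSchreierRange_iff
  have two0 : (2 : F) = 0 := CharTwo.two_eq_zero
  have hd0 : d ≠ 0 := by rintro rfl; exact hd (by simp [R.zero_mem])
  -- Since `(c + d) ^ 3 - c ^ 3 = d (c ^ 2 + d c + d ^ 2)` in characteristic two, the last condition
  -- says `c ^ 3 ≠ e ^ 3` for `e = c + d`. It excludes few of the at least `q / 2` candidates.
  obtain ⟨c, hcR, hc0, hcd⟩ : ∃ c, h * c ∈ R ∧ c ≠ 0 ∧ c ^ 2 + d * c + d ^ 2 ≠ 0 := by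
    let T : Finset F := Finset.univ.filter fun x => h * x ∈ R
    have hT : Fintype.card F ≤ 2 * T.card := by
      refine card_le_two_mul_card_of_translate T d fun x => ?_
      simp only [T, Finset.mem_filter, Finset.mem_univ, true_and, mul_add, radd]
      tauto
    let p : F[X] := X * (X ^ 2 + C d * X + C (d ^ 2))
    have hm : p.natDegree = 3 ∧ p.Monic := by
      constructor
      · simp only [p]; compute_degree!
      · simp only [p]; monicity!
    have hp := card_filter_eval_eq_zero_le p hm.2.ne_zero 3 hm.1.le
    obtain ⟨c, hc, hc'⟩ := Finset.exists_mem_notMem_of_card_lt_card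
      (show (Finset.univ.filter fun x => p.eval x = 0).card < T.card by omega)
    simp [T] at hc
    simp [p] at hc'
    exact ⟨c, hc, hc'.1, hc'.2⟩
  set e := c + d with he
  have heR : h * e ∉ R := by rw [he, mul_add, radd]; tauto
  have he0 : e ≠ 0 := by rintro h0; exact heR (by simp [h0, R.zero_mem])
  -- Substituting `y = e v` and dividing by `e ^ 3` turns the equation for `y` into `v ^ 2 + v = E x
  -- + ε`.
  let E : F → F := fun x => (c * x ^ 2 + c ^ 2 * x) / e ^ 3
  have Eadd : ∀ x y, E (x + y) = E x + E y := by
    intro x y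
    simp only [E, CharTwo.add_sq]; ring
  -- Hence translating `x` by `d` preserves solvability for `y` while it switches sides of the
  -- hyperplane.
  have Ed : E d ∈ R := by
    refine ⟨c / e, ?_⟩
    simp only [E]
    field_simp
    rw [he]
    linear_combination (c * d + c ^ 2) * two0
  -- Modulo `R` every square `z ^ 2` equals `z`, so `E x` is congruent to `(g + c ^ 2 / e ^ 3) x`.
  -- This factor vanishes only if `c ^ 3 = e ^ 3`.
  obtain ⟨x₀, hx₀⟩ : ∃ x, E x ∉ R := by
    obtain ⟨g, hg⟩ : ∃ g : F, g ^ 2 = c / e ^ 3 := by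
      obtain ⟨g, hg⟩ := (PerfectRing.bijective_frobenius (R := F) (p := 2)).2 (c / e ^ 3)
      exact ⟨g, hg⟩
    have hm : g + c ^ 2 / e ^ 3 ≠ 0 := by
      intro h0
      have h1 : g = c ^ 2 / e ^ 3 := by rwa [CharTwo.add_eq_zero] at h0
      rw [h1] at hg
      field_simp at hg
      have h3 : c ^ 3 = e ^ 3 := by
        exact hg
      refine mul_ne_zero hd0 hcd ?_
      rw [he] at h3
      linear_combination (c * d ^ 2 + c ^ 2 * d) * (-two0) - h3
    obtain ⟨ζ, hζ⟩ := exists_notMem_artinSchreierRange F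
    refine ⟨ζ / (g + c ^ 2 / e ^ 3), fun hE => hζ ?_⟩
    set x := ζ / (g + c ^ 2 / e ^ 3) with hx
    have h1 : ζ = E x + ((g * x) ^ 2 + g * x) := by
      have h2 : ζ = (g + c ^ 2 / e ^ 3) * x := by
        rw [hx, mul_comm, div_mul_cancel₀ _ hm]
      simp only [E]
      rw [h2, mul_pow, hg]
      linear_combination (-c * x ^ 2 / e ^ 3) * two0
    rw [h1]
    exact R.add_mem hE ⟨_, rfl⟩
  set ε := (κ + d * c * e) / e ^ 3 with hε
  let T : Finset F := Finset.univ.filter fun x => h * x ∉ R ∧ E x + ε ∈ R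
  have hT : 4 ≤ T.card := by
    let T' : Finset F := Finset.univ.filter fun x => E x + ε ∈ R
    have h1 : Fintype.card F ≤ 2 * T'.card := by
      refine card_le_two_mul_card_of_translate T' x₀ fun x => ?_
      simp only [T', Finset.mem_filter, Finset.mem_univ, true_and, Eadd, radd]
      tauto
    have h2 : T' ⊆ T ∪ T.image (· + d) := by
      intro x hx
      by_cases hxR : h * x ∈ R
      · refine Finset.mem_union_right _ (Finset.mem_image.2 ⟨x + d, ?_, ?_⟩)
        · simp only [T, T', Finset.mem_filter, Finset.mem_univ, true_and, Eadd, mul_add, radd]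
            at hx ⊢
          tauto
        · linear_combination d * two0
      · refine Finset.mem_union_left _ ?_
        simp only [T, T', Finset.mem_filter, Finset.mem_univ, true_and] at hx ⊢
        exact ⟨hxR, hx⟩
    have h3 := Finset.card_le_card h2
    have h4 := Finset.card_union_le T (T.image (· + d))
    have h5 : (T.image (· + d)).card ≤ T.card := Finset.card_image_le
    omega
  -- `y = x` forces `P x = 0`, and `y = x + c` forces `P (x + c) = 0`. Roots of `P` differ by `d`,
  -- so at most one lies off the hyperplane: two bad `x` against at least four candidates.
  let P : F → F := fun x => d * x ^ 2 + d ^ 2 * x + (κ + d * c * e)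
  have hP : ∀ x y, h * x ∉ R → h * y ∉ R → P x = 0 → P y = 0 → x = y := by
    intro x y hx hy hPx hPy
    have h1 : d * ((x + y) * (x + y + d)) = 0 := by
      simp only [P] at hPx hPy
      linear_combination hPx + hPy + (d * x * y - (κ + d * c * e)) * two0
    have h2 := (mul_eq_zero.1 h1).resolve_left hd0
    rcases mul_eq_zero.1 h2 with h3 | h3
    · rwa [CharTwo.add_eq_zero] at h3
    · exfalso
      have h4 : h * x + h * y + h * d ∈ R := by
        rw [← mul_add, ← mul_add, h3, mul_zero]; exact R.zero_mem
      rw [radd, radd] at h4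
      tauto
  let B₁ : Finset F := Finset.univ.filter fun x => h * x ∉ R ∧ P x = 0
  let B₂ : Finset F := Finset.univ.filter fun x => h * x ∉ R ∧ P (x + c) = 0
  have hB₁ : B₁.card ≤ 1 := by
    refine Finset.card_le_one.2 fun a ha b hb => ?_
    simp only [B₁, Finset.mem_filter, Finset.mem_univ, true_and] at ha hb
    exact hP a b ha.1 hb.1 ha.2 hb.2
  have hB₂ : B₂.card ≤ 1 := by
    refine Finset.card_le_one.2 fun a ha b hb => ?_
    simp only [B₂, Finset.mem_filter, Finset.mem_univ, true_and] at ha hb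
    refine add_right_cancel (hP (a + c) (b + c) ?_ ?_ ha.2 hb.2) <;> rw [mul_add, radd] <;> tauto
  have hB := Finset.card_union_le B₁ B₂
  obtain ⟨x, hxT, hxB⟩ := Finset.exists_mem_notMem_of_card_lt_card
    (show (B₁ ∪ B₂).card < T.card by omega)
  simp only [T, Finset.mem_filter, Finset.mem_univ, true_and] at hxT
  obtain ⟨hxR, v, hv⟩ := hxT
  have hxcR : h * (x + c) ∉ R := by rw [mul_add, radd]; tauto
  simp only [B₁, B₂, Finset.mem_union, Finset.mem_filter, Finset.mem_univ, true_and, not_or,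
    not_and] at hxB
  obtain ⟨y, hyR, hy⟩ : ∃ y, h * y ∉ R ∧
      κ + d * c * e + c * (x ^ 2 + c * x) + e * (y ^ 2 + e * y) = 0 := by
    have hv' : κ + d * c * e + c * (x ^ 2 + c * x) + e * ((e * v) ^ 2 + e * (e * v)) = 0 := by
      simp only [E, hε] at hv
      field_simp at hv
      linear_combination hv + (κ + d * c * e + c * (x ^ 2 + c * x)) * two0
    -- The two solutions differ by `e`, which is off the hyperplane, so one of them is off it as
    -- well.
    by_cases hy : h * (e * v) ∈ R
    · refine ⟨e * v + e, by rw [mul_add, radd]; tauto, ?_⟩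
      linear_combination hv' + (e ^ 3 * v + e ^ 3) * two0
    · exact ⟨e * v, hy, hv'⟩
  refine ⟨c, x, y, hxR, hxcR, hyR, hc0, ?_, ?_, hy⟩
  · rintro rfl
    refine hxB.1 hxR ?_
    simp only [P]
    rw [he] at hy ⊢
    linear_combination hy - (c * y ^ 2 + c ^ 2 * y + c * d * y) * two0
  · rintro rfl
    refine hxB.2 hxR ?_
    simp only [P]
    rw [he] at hy ⊢
    linear_combination
      hy - (c * x ^ 2 + c ^ 2 * x + d * x * c + d * c ^ 2 + x * c ^ 2 + c ^ 3) * two0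

/-- A set too small to exhaust the field leaves room for two elements differing by `d` and a
third element solving an equation that is bilinear in `x ^ 2 + d * x` and `y ^ 2`. -/
theorem exists_pair_and_double_root {F : Type*} [Field F] [Fintype F] [DecidableEq F]
    [CharP F 2] (A : Finset F) (hA : 4 * A.card + 10 < Fintype.card F) (d v₀ v₁ v₂ w : F)
    (hd : d ≠ 0) (hv : v₀ ≠ 0 ∨ v₂ + d * v₁ ≠ 0) (hvA : ∀ a ∈ A, v₂ + a ^ 2 * v₀ ≠ 0) :
    ∃ x y : F, x ∉ A ∧ x + d ∉ A ∧ y ∉ A ∧ y ≠ x ∧ y ≠ x + d ∧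
      w + (x ^ 2 + d * x + y ^ 2) * v₂ + d * y ^ 2 * v₁ + (x ^ 2 + d * x) * y ^ 2 * v₀ = 0 := by
  classical
  have two0 : (2 : F) = 0 := CharTwo.two_eq_zero
  -- As polynomials in `x`: `P` is the equation at `y = x`, and its translate by `d` is the one at
  -- `y = x + d`; `D` is the coefficient of `y ^ 2`; `K a` is the equation at `y = a`.
  let P : F[X] := C v₀ * X ^ 4 + C (d * v₀) * X ^ 3 + C (d * v₁) * X ^ 2 + C (d * v₂) * X + C w
  let D : F[X] := C v₀ * X ^ 2 + C (d * v₀) * X + C (v₂ + d * v₁)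
  let K : F → F[X] := fun a => C (v₂ + a ^ 2 * v₀) * X ^ 2 + C (d * (v₂ + a ^ 2 * v₀)) * X +
    C (w + a ^ 2 * (v₂ + d * v₁))
  have hP : P ≠ 0 := by
    intro h
    have h4 : P.coeff 4 = v₀ := by simp [P, -map_mul, -map_add]
    have h2 : P.coeff 2 = d * v₁ := by simp [P, -map_mul, -map_add]
    have h1 : P.coeff 1 = d * v₂ := by simp [P, coeff_C, -map_mul, -map_add]
    rw [h, coeff_zero] at h4 h2 h1
    rcases hv with hv | hv
    · exact hv h4.symm
    · have : v₂ = 0 := by simpa [hd] using h1.symm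
      rw [this, ← h2, add_zero] at hv
      exact hv rfl
  have hD : D ≠ 0 := by
    intro h
    have h2 : D.coeff 2 = v₀ := by simp [D, -map_mul, -map_add]
    have h0 : D.coeff 0 = v₂ + d * v₁ := by simp [D]
    rw [h, coeff_zero] at h2 h0
    rcases hv with hv | hv
    · exact hv h2.symm
    · exact hv h0.symm
  have hK : ∀ a ∈ A, K a ≠ 0 := by
    intro a ha h
    have h2 : (K a).coeff 2 = v₂ + a ^ 2 * v₀ := by simp [K, -map_mul, -map_add]
    rw [h, coeff_zero] at h2
    exact hvA a ha h2.symm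
  let Z : F[X] → Finset F := fun p => Finset.univ.filter fun x => p.eval x = 0
  have hZP : (Z P).card ≤ 4 := card_filter_eval_eq_zero_le P hP 4 (by simp only [P]; compute_degree)
  have hZD : (Z D).card ≤ 2 := card_filter_eval_eq_zero_le D hD 2 (by simp only [D]; compute_degree)
  have hZK : (A.biUnion fun a => Z (K a)).card ≤ A.card * 2 :=
    Finset.card_biUnion_le_card_mul _ _ _ fun a ha =>
      card_filter_eval_eq_zero_le (K a) (hK a ha) 2 (by simp only [K]; compute_degree)
  have hi : ∀ S : Finset F, (S.image (· + d)).card ≤ S.card := fun S => Finset.card_image_le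
  let B := (A ∪ A.image (· + d)) ∪ (Z P ∪ (Z P).image (· + d)) ∪
    (Z D ∪ A.biUnion fun a => Z (K a))
  have hB : B.card < (Finset.univ : Finset F).card := by
    have h1 := Finset.card_union_le ((A ∪ A.image (· + d)) ∪ (Z P ∪ (Z P).image (· + d)))
      (Z D ∪ A.biUnion fun a => Z (K a))
    have h2 := Finset.card_union_le (A ∪ A.image (· + d)) (Z P ∪ (Z P).image (· + d))
    have h3 := Finset.card_union_le (Z D) (A.biUnion fun a => Z (K a))
    have h4 := Finset.card_union_le A (A.image (· + d))
    have h5 := Finset.card_union_le (Z P) ((Z P).image (· + d))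
    have h6 := hi A
    have h7 := hi (Z P)
    rw [Finset.card_univ]
    simp only [B]
    omega
  obtain ⟨x, -, hx⟩ := Finset.exists_mem_notMem_of_card_lt_card hB
  have hmem : ∀ (S : Finset F), x + d ∈ S → x ∈ S.image (· + d) := fun S h =>
    Finset.mem_image.2 ⟨_, h, by linear_combination d * two0⟩
  simp only [B, Finset.mem_union, not_or] at hx
  obtain ⟨⟨⟨hxA, hxA'⟩, hxP, hxP'⟩, hxD, hxK⟩ := hx
  replace hxP' : x + d ∉ Z P := fun h => hxP' (hmem _ h)
  have hxKa : ∀ a ∈ A, (K a).eval x ≠ 0 := by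
    intro a ha h
    exact hxK (Finset.mem_biUnion.2 ⟨a, ha, by simpa [Z] using h⟩)
  simp only [Z, Finset.mem_filter, Finset.mem_univ, true_and] at hxP hxP' hxD
  set z := x ^ 2 + d * x with hz
  have hden : v₂ + d * v₁ + z * v₀ ≠ 0 := by
    intro h; apply hxD
    simp only [D, eval_add, eval_mul, eval_C, eval_pow, eval_X]
    rw [hz] at h
    linear_combination h
  obtain ⟨y, hy⟩ : ∃ y : F, y ^ 2 = (w + z * v₂) / (v₂ + d * v₁ + z * v₀) := by
    obtain ⟨g, hg⟩ := (PerfectRing.bijective_frobenius (R := F) (p := 2)).2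
      ((w + z * v₂) / (v₂ + d * v₁ + z * v₀))
    exact ⟨g, hg⟩
  have hy' : w + z * v₂ + y ^ 2 * (v₂ + d * v₁ + z * v₀) = 0 := by
    rw [hy, div_mul_cancel₀ _ hden]
    linear_combination (w + z * v₂) * two0
  refine ⟨x, y, hxA, fun h => hxA' (hmem _ h), fun h => hxKa y h ?_, ?_, ?_, ?_⟩
  · simp only [K, eval_add, eval_mul, eval_C, eval_pow, eval_X]
    rw [hz] at hy'
    linear_combination hy'
  · rintro rfl
    apply hxP
    simp only [P, eval_add, eval_mul, eval_C, eval_pow, eval_X]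
    rw [hz] at hy'
    linear_combination hy' - v₂ * y ^ 2 * two0
  · rintro rfl
    apply hxP'
    simp only [P, eval_add, eval_mul, eval_C, eval_pow, eval_X]
    rw [hz] at hy'
    linear_combination hy' + (3 * v₀ * x * d ^ 3 + 3 * v₀ * x ^ 2 * d ^ 2 + v₀ * x ^ 3 * d +
      v₀ * d ^ 4 - x * d * v₂ - x ^ 2 * v₂) * two0
  · linear_combination hy'

/-! ### Twists of functionals and greedy choice of points -/

/-- `∏ (X + a)` over the elements `a` of a finite set. -/
noncomputable def rootPoly {F : Type*} [CommRing F] (A : Finset F) : F[X] := ∏ a ∈ A, (X + C a)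

/-- The functional `p ↦ s (g * p)`. -/
noncomputable def twist {F : Type*} [Field F] (s : F[X] →ₗ[F] F) (g : F[X]) : F[X] →ₗ[F] F :=
  s ∘ₗ LinearMap.mulLeft F g

theorem twist_apply {F : Type*} [Field F] (s : F[X] →ₗ[F] F) (g p : F[X]) :
    twist s g p = s (g * p) := rfl

theorem apply_C_mul {F : Type*} [Field F] (s : F[X] →ₗ[F] F) (a : F) (p : F[X]) :
    s (C a * p) = a * s p := by rw [← smul_eq_C_mul, map_smul, smul_eq_mul]

/-- A functional does not vanish on the polynomials of degree at most `n`. -/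
def NonzeroUpTo {F : Type*} [Field F] (s : F[X] →ₗ[F] F) (n : ℕ) : Prop :=
  ∃ j ≤ n, s (X ^ j) ≠ 0

theorem NonzeroUpTo.mono {F : Type*} [Field F] {s : F[X] →ₗ[F] F} {m n : ℕ}
    (h : NonzeroUpTo s m) (hmn : m ≤ n) : NonzeroUpTo s n :=
  h.imp fun _ hj => ⟨hj.1.trans hmn, hj.2⟩

theorem apply_eq_zero_of_not_nonzeroUpTo {F : Type*} [Field F] {s : F[X] →ₗ[F] F} {n : ℕ}
    (h : ¬ NonzeroUpTo s n) {p : F[X]} (hp : p.natDegree ≤ n) : s p = 0 := by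
  rw [p.as_sum_range' (n + 1) (by omega), map_sum]
  refine Finset.sum_eq_zero fun j hj => ?_
  rw [← C_mul_X_pow_eq_monomial, apply_C_mul]
  by_contra h'
  exact h ⟨j, by simpa [Nat.lt_succ_iff] using hj, right_ne_zero_of_mul h'⟩

/-- For `a ≠ b` the multiples of `X + a` and `X + b` by polynomials of degree `≤ n` together span
degree `≤ n + 1`. -/
theorem card_not_nonzeroUpTo_twist_le_one {F : Type*} [Field F] [Fintype F] [DecidableEq F]
    [CharP F 2] {s : F[X] →ₗ[F] F} {n : ℕ} (h : NonzeroUpTo s (n + 1)) (B : Finset F)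
    (hB : ∀ a ∈ B, ¬ NonzeroUpTo (twist s (X + C a)) n) : B.card ≤ 1 := by
  refine Finset.card_le_one.2 fun a ha b hb => ?_
  by_contra hab
  have key : ∀ c ∈ B, ∀ j ≤ n, s (X ^ (j + 1)) + c * s (X ^ j) = 0 := by
    intro c hc j hj
    have h1 : twist s (X + C c) (X ^ j) = 0 := by
      by_contra h'; exact hB c hc ⟨j, hj, h'⟩
    rw [twist_apply, add_mul, map_add, apply_C_mul] at h1
    rwa [pow_succ']
  have h0 : ∀ j ≤ n, s (X ^ j) = 0 := by
    intro j hj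
    have h1 : (a - b) * s (X ^ j) = 0 := by
      linear_combination key a ha j hj - key b hb j hj
    exact (mul_eq_zero.1 h1).resolve_left (sub_ne_zero.2 hab)
  obtain ⟨j, hj, hs⟩ := h
  apply hs
  rcases Nat.lt_or_ge n j with h1 | h1
  · have h2 := key a ha n le_rfl
    rw [h0 n le_rfl, mul_zero, add_zero] at h2
    rwa [show j = n + 1 by omega]
  · exact h0 j h1

/-- A bad `a` is a root of the cubic whose coefficients are four consecutive values `s (X ^ i), …, s
(X ^ (i + 3))`, with the window chosen to contain a nonzero one. -/
theorem card_not_nonzeroUpTo_twist_cube_le {F : Type*} [Field F] [Fintype F] [DecidableEq F]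
    [CharP F 2] {s : F[X] →ₗ[F] F} {n : ℕ} (h : NonzeroUpTo s (n + 3)) (B : Finset F)
    (hB : ∀ a ∈ B, ¬ NonzeroUpTo (twist s ((X + C a) ^ 3)) n) : B.card ≤ 3 := by
  obtain ⟨j, hj, hs⟩ := h
  obtain ⟨i, m, hi, hm, rfl⟩ : ∃ i m, i ≤ n ∧ m ≤ 3 ∧ j = i + m :=
    ⟨min j n, j - min j n, by omega, by omega, by omega⟩
  have two0 : (2 : F) = 0 := CharTwo.two_eq_zero
  have two0' : (2 : F[X]) = 0 := CharTwo.two_eq_zero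
  let p : F[X] := C (s (X ^ i)) * X ^ 3 + C (s (X ^ (i + 1))) * X ^ 2 + C (s (X ^ (i + 2))) * X +
    C (s (X ^ (i + 3)))
  have hp : p ≠ 0 := by
    intro h
    have h3 : p.coeff 3 = s (X ^ i) := by simp [p, -map_mul, -map_add]
    have h2 : p.coeff 2 = s (X ^ (i + 1)) := by simp [p, -map_mul, -map_add]
    have h1 : p.coeff 1 = s (X ^ (i + 2)) := by simp [p, coeff_C, -map_mul, -map_add]
    have h0 : p.coeff 0 = s (X ^ (i + 3)) := by simp [p]
    rw [h, coeff_zero] at h0 h1 h2 h3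
    interval_cases m
    · exact hs h3.symm
    · exact hs h2.symm
    · exact hs h1.symm
    · exact hs h0.symm
  refine (Finset.card_le_card ?_).trans
    (card_filter_eval_eq_zero_le p hp 3 (by simp only [p]; compute_degree))
  intro a ha
  have h1 : twist s ((X + C a) ^ 3) (X ^ i) = 0 := by
    by_contra h'; exact hB a ha ⟨i, hi, h'⟩
  have h2 : (X + C a) ^ 3 * X ^ i = X ^ (i + 3) + C a * X ^ (i + 2) + C (a ^ 2) * X ^ (i + 1) +
      C (a ^ 3) * X ^ i := by
    rw [C_pow, C_pow]
    linear_combination (X ^ (i + 2) * C a + X ^ (i + 1) * C a ^ 2) * two0'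
  rw [twist_apply, h2, map_add, map_add, map_add, apply_C_mul, apply_C_mul, apply_C_mul] at h1
  simp only [Finset.mem_filter, Finset.mem_univ, true_and, p, eval_add, eval_mul, eval_C,
    eval_pow, eval_X]
  linear_combination h1

theorem twist_twist {F : Type*} [Field F] (s : F[X] →ₗ[F] F) (g h : F[X]) :
    twist (twist s g) h = twist s (g * h) := by
  refine LinearMap.ext fun p => ?_
  simp only [twist_apply, mul_assoc]

theorem rootPoly_insert {F : Type*} [CommRing F] [DecidableEq F] {A : Finset F} {a : F}
    (ha : a ∉ A) : rootPoly (insert a A) = (X + C a) * rootPoly A :=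
  Finset.prod_insert ha

theorem natDegree_rootPoly {F : Type*} [Field F] (A : Finset F) :
    (rootPoly A).natDegree = A.card := by
  rw [rootPoly, natDegree_prod_of_monic _ _ fun a _ => monic_X_add_C a]
  simp

theorem rootPoly_mul_X_sq {F : Type*} [Field F] [DecidableEq F] (A : Finset F) :
    ∃ R : F[X], R.natDegree ≤ A.card ∧
      rootPoly A * X ^ 2 = X ^ (A.card + 2) + C (∑ a ∈ A, a) * X ^ (A.card + 1) + R := by
  induction A using Finset.induction_on with
  | empty => exact ⟨0, by simp, by simp [rootPoly]⟩
  | insert a A ha ih =>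
    obtain ⟨R, hR, h⟩ := ih
    refine ⟨C (a * ∑ a ∈ A, a) * X ^ (A.card + 1) + (X + C a) * R, ?_, ?_⟩
    · rw [Finset.card_insert_of_notMem ha]
      refine natDegree_add_le_of_degree_le (natDegree_C_mul_X_pow_le _ _) ?_
      refine natDegree_mul_le.trans ?_
      rw [natDegree_X_add_C]
      omega
    · rw [rootPoly_insert ha, mul_assoc, h, Finset.card_insert_of_notMem ha,
        Finset.sum_insert ha, C_add, C_mul]
      ring

theorem rootPoly_mul_X {F : Type*} [Field F] [DecidableEq F] (A : Finset F) :
    ∃ R : F[X], R.natDegree ≤ A.card ∧ rootPoly A * X = X ^ (A.card + 1) + R := by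
  induction A using Finset.induction_on with
  | empty => exact ⟨0, by simp, by simp [rootPoly]⟩
  | insert a A ha ih =>
    obtain ⟨R, hR, h⟩ := ih
    refine ⟨C a * X ^ (A.card + 1) + (X + C a) * R, ?_, ?_⟩
    · rw [Finset.card_insert_of_notMem ha]
      refine natDegree_add_le_of_degree_le (natDegree_C_mul_X_pow_le _ _) ?_
      refine natDegree_mul_le.trans ?_
      rw [natDegree_X_add_C]
      omega
    · rw [rootPoly_insert ha, mul_assoc, h, Finset.card_insert_of_notMem ha]
      ring

/-- Greedy choice of points keeping several twists of a functional nonzero. -/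
theorem exists_finset_nonzeroUpTo_twist {F : Type*} [Field F] [Fintype F] [DecidableEq F]
    [CharP F 2] (s : F[X] →ₗ[F] F) (t : F) (ht : t ≠ 0) (N f : ℕ) (hf : f ≤ 2)
    (hN : 2 * N + 3 < Fintype.card F) (hs : NonzeroUpTo s (N + f)) (i : ℕ) (hi : i ≤ N) :
    ∃ A : Finset F, A.card = i ∧ NonzeroUpTo (twist s (rootPoly A)) (N - i + f) ∧
      (∀ a ∈ A, NonzeroUpTo (twist s (rootPoly A * (X + C a) ^ 2)) (N - i)) ∧
      t + ∑ a ∈ A, a ≠ 0 := by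
  classical
  induction i with
  | zero =>
    refine ⟨∅, rfl, ?_, by simp, by simpa using ht⟩
    obtain ⟨j, hj, h⟩ := hs
    exact ⟨j, by simpa using hj, by simpa [twist_apply, rootPoly] using h⟩
  | succ i ih =>
    obtain ⟨A, hA, h1, h2, h3⟩ := ih (by omega)
    obtain ⟨n, hn⟩ : ∃ n, N - i = n + 1 := ⟨N - i - 1, by omega⟩
    have hn' : N - (i + 1) = n := by omega
    rw [hn] at h1 h2
    let B₁ : Finset F := Finset.univ.filter fun a =>
      ¬ NonzeroUpTo (twist (twist s (rootPoly A)) (X + C a)) (n + f)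
    let B₂ : F → Finset F := fun b => Finset.univ.filter fun a =>
      ¬ NonzeroUpTo (twist (twist s (rootPoly A * (X + C b) ^ 2)) (X + C a)) n
    -- For the new point itself, `rootPoly (insert a A) * (X + C a) ^ 2` contains the factor `(X + C
    -- a) ^ 3`.
    let B₃ : Finset F := Finset.univ.filter fun a =>
      ¬ NonzeroUpTo (twist (twist s (rootPoly A)) ((X + C a) ^ 3)) n
    have hB₁ : B₁.card ≤ 1 := card_not_nonzeroUpTo_twist_le_one
      (h1.mono (by omega)) B₁ fun a ha => (Finset.mem_filter.1 ha).2
    have hB₂ : (A.biUnion B₂).card ≤ A.card * 1 :=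
      Finset.card_biUnion_le_card_mul _ _ _ fun b hb => card_not_nonzeroUpTo_twist_le_one
        (h2 b hb) (B₂ b) fun a ha => (Finset.mem_filter.1 ha).2
    have hB₃ : B₃.card ≤ 3 := card_not_nonzeroUpTo_twist_cube_le
      (h1.mono (by omega)) B₃ fun a ha => (Finset.mem_filter.1 ha).2
    let B := (A ∪ B₁) ∪ (A.biUnion B₂ ∪ (B₃ ∪ {t + ∑ a ∈ A, a}))
    have hB : B.card < (Finset.univ : Finset F).card := by
      have k1 := Finset.card_union_le (A ∪ B₁) (A.biUnion B₂ ∪ (B₃ ∪ {t + ∑ a ∈ A, a}))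
      have k2 := Finset.card_union_le A B₁
      have k3 := Finset.card_union_le (A.biUnion B₂) (B₃ ∪ {t + ∑ a ∈ A, a})
      have k4 := Finset.card_union_le B₃ {t + ∑ a ∈ A, a}
      rw [Finset.card_singleton] at k4
      rw [Finset.card_univ]
      simp only [B]
      omega
    obtain ⟨b, -, hb⟩ := Finset.exists_mem_notMem_of_card_lt_card hB
    simp only [B, Finset.mem_union, not_or, Finset.mem_singleton] at hb
    obtain ⟨⟨hbA, hb₁⟩, hb₂, hb₃, hbt⟩ := hb
    have hb₂' : ∀ a ∈ A, b ∉ B₂ a := fun a ha h => hb₂ (Finset.mem_biUnion.2 ⟨a, ha, h⟩)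
    simp only [B₁, B₂, B₃, Finset.mem_filter, Finset.mem_univ, true_and, not_not, twist_twist]
      at hb₁ hb₂' hb₃
    refine ⟨insert b A, by rw [Finset.card_insert_of_notMem hbA, hA], ?_, ?_, ?_⟩
    · rw [rootPoly_insert hbA, mul_comm, hn']
      exact hb₁
    · intro a ha
      rw [rootPoly_insert hbA, hn']
      rcases Finset.mem_insert.1 ha with rfl | ha
      · convert hb₃ using 2
        ring
      · convert hb₂' a ha using 2
        ring
    · rw [Finset.sum_insert hbA]
      intro h
      apply hbt
      rw [← CharTwo.add_eq_zero, ← h]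
      ring

/-! ### Construction of the error support -/

/-- Adding `x`, `x + d` and `y` to `A` makes `t + ∑ B` equal to `y`, so `y` is a double root. `hvA`
keeps `y` out of `A`. -/
theorem exists_card_eq_rootPoly_of_pair_double {F : Type*} [Field F] [Fintype F] [DecidableEq F]
    [CharP F 2] (s : F[X] →ₗ[F] F) (t : F) (A : Finset F)
    (hA : 4 * A.card + 10 < Fintype.card F) (hd : t + ∑ a ∈ A, a ≠ 0)
    (hv : s (rootPoly A) ≠ 0 ∨
      s (rootPoly A * X ^ 2) + (t + ∑ a ∈ A, a) * s (rootPoly A * X) ≠ 0)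
    (hvA : ∀ a ∈ A, s (rootPoly A * (X + C a) ^ 2) ≠ 0) :
    ∃ B : Finset F, B.card = A.card + 3 ∧ s (rootPoly B * (X + C (t + ∑ b ∈ B, b))) = 0 := by
  have two0 : (2 : F) = 0 := CharTwo.two_eq_zero
  have two0' : (2 : F[X]) = 0 := CharTwo.two_eq_zero
  set d := t + ∑ a ∈ A, a with hd'
  set P := rootPoly A with hP
  obtain ⟨x, y, hx, hxd, hy, hyx, hyxd, h⟩ := exists_pair_and_double_root A hA d (s P) (s (P * X))
    (s (P * X ^ 2)) (s (P * X ^ 4) + d * s (P * X ^ 3)) hd hv fun a ha h => hvA a ha <| by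
      rw [CharTwo.add_sq, ← C_pow, mul_add, map_add, mul_comm P (C _), apply_C_mul]
      exact h
  have hxx : x + d ∉ insert x A := by
    simp [hxd, hd]
  have hyy : y ∉ insert (x + d) (insert x A) := by
    simp [hy, hyx, hyxd]
  refine ⟨insert y (insert (x + d) (insert x A)), ?_, ?_⟩
  · rw [Finset.card_insert_of_notMem hyy, Finset.card_insert_of_notMem hxx,
      Finset.card_insert_of_notMem hx]
  · have hsum : t + ∑ b ∈ insert y (insert (x + d) (insert x A)), b = y := by
      rw [Finset.sum_insert hyy, Finset.sum_insert hxx, Finset.sum_insert hx]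
      linear_combination (x + d) * two0 - hd'
    rw [hsum, rootPoly_insert hyy, rootPoly_insert hxx, rootPoly_insert hx, ← hP]
    have hexp : (X + C y) * ((X + C (x + d)) * ((X + C x) * P)) * (X + C y) =
        P * X ^ 4 + C d * (P * X ^ 3) + C (x ^ 2 + d * x + y ^ 2) * (P * X ^ 2) +
          C (d * y ^ 2) * (P * X) + C ((x ^ 2 + d * x) * y ^ 2) * P := by
      simp only [C_add, C_mul, C_pow]
      linear_combination (P * (X + C y) ^ 2 * C x * X +
        P * C y * X * (X ^ 2 + C d * X + C x ^ 2 + C d * C x)) * two0'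
    rw [hexp, map_add s, map_add s, map_add s, map_add s, apply_C_mul, apply_C_mul, apply_C_mul,
      apply_C_mul]
    linear_combination h

/-- Here `s P = 0` and `s (P X ^ 2) = d s (P X)` for every `A` of size `N`, so with a double root
`y` drops out of the equation. Points of `A` inside a hyperplane cannot meet `x`, `x + c`, `y`
outside it; the fourth root `y + c + d` need not avoid anything. -/
theorem exists_card_eq_rootPoly_of_degenerate {F : Type*} [Field F] [Fintype F] [DecidableEq F]
    [CharP F 2] (hq : 16 ≤ Fintype.card F) (s : F[X] →ₗ[F] F) (t : F) (ht : t ≠ 0) (N : ℕ)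
    (hN : 2 * N ≤ Fintype.card F) (h0 : ¬ NonzeroUpTo s N) (h1 : s (X ^ (N + 1)) ≠ 0)
    (h2 : s (X ^ (N + 2)) + t * s (X ^ (N + 1)) = 0) :
    ∃ B : Finset F, B.card = N + 3 ∧ s (rootPoly B * (X + C (t + ∑ b ∈ B, b))) = 0 := by
  classical
  have two0 : (2 : F) = 0 := CharTwo.two_eq_zero
  have two0' : (2 : F[X]) = 0 := CharTwo.two_eq_zero
  have radd : ∀ x y : F, x + y ∈ artinSchreierRange F ↔
      (x ∈ artinSchreierRange F ↔ y ∈ artinSchreierRange F) := fun x y =>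
    add_mem_artinSchreierRange_iff
  obtain ⟨ζ, hζ⟩ := exists_notMem_artinSchreierRange F
  have hht : ζ / t * t ∉ artinSchreierRange F := by rwa [div_mul_cancel₀ _ ht]
  generalize ζ / t = h at hht
  let H : Finset F := Finset.univ.filter fun x => h * x ∈ artinSchreierRange F
  have hH : N ≤ H.card := by
    have : Fintype.card F ≤ 2 * H.card := by
      refine card_le_two_mul_card_of_translate H t fun x => ?_
      simp only [H, Finset.mem_filter, Finset.mem_univ, true_and, mul_add, radd]
      tauto
    omega
  obtain ⟨A, hAH, rfl⟩ := Finset.exists_subset_card_eq hH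
  have hA : ∀ a ∈ A, h * a ∈ artinSchreierRange F := fun a ha => (Finset.mem_filter.1 (hAH ha)).2
  set d := t + ∑ a ∈ A, a with hd'
  have hd : h * d ∉ artinSchreierRange F := by
    have : h * ∑ a ∈ A, a ∈ artinSchreierRange F := by
      rw [Finset.mul_sum]
      exact sum_mem hA
    rw [hd', mul_add, radd]
    tauto
  set P := rootPoly A with hP
  have v0 : s P = 0 := apply_eq_zero_of_not_nonzeroUpTo h0 (natDegree_rootPoly A).le
  have v1 : s (P * X) = s (X ^ (A.card + 1)) := by
    obtain ⟨R, hR, hh⟩ := rootPoly_mul_X A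
    rw [hP, hh, map_add, apply_eq_zero_of_not_nonzeroUpTo h0 hR, add_zero]
  have v2 : s (P * X ^ 2) = d * s (P * X) := by
    obtain ⟨R, hR, hh⟩ := rootPoly_mul_X_sq A
    rw [v1, hP, hh, map_add, map_add, apply_eq_zero_of_not_nonzeroUpTo h0 hR, apply_C_mul, hd']
    linear_combination h2 - t * s (X ^ (A.card + 1)) * two0
  rw [← v1] at h1
  obtain ⟨c, x, y, hx, hxc, hy, hc, hyx, hyxc, heq⟩ := exists_four_roots_off_hyperplane hq h d
    ((s (P * X ^ 4) + d * s (P * X ^ 3)) / s (P * X)) hd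
  have hxx : x + c ∉ insert x A := by
    simp only [Finset.mem_insert, add_eq_left, hc, false_or]
    exact fun hh => hxc (hA _ hh)
  have hxA : x ∉ A := fun hh => hx (hA _ hh)
  have hyy : y ∉ insert (x + c) (insert x A) := by
    simp only [Finset.mem_insert, hyx, hyxc, false_or]
    exact fun hh => hy (hA _ hh)
  refine ⟨insert y (insert (x + c) (insert x A)), ?_, ?_⟩
  · rw [Finset.card_insert_of_notMem hyy, Finset.card_insert_of_notMem hxx,
      Finset.card_insert_of_notMem hxA]
  · have hsum : t + ∑ b ∈ insert y (insert (x + c) (insert x A)), b = y + (c + d) := by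
      rw [Finset.sum_insert hyy, Finset.sum_insert hxx, Finset.sum_insert hxA]
      linear_combination x * two0 - hd'
    rw [hsum, rootPoly_insert hyy, rootPoly_insert hxx, rootPoly_insert hxA, ← hP]
    have hexp : (X + C y) * ((X + C (x + c)) * ((X + C x) * P)) * (X + C (y + (c + d))) =
        P * X ^ 4 + C d * (P * X ^ 3) +
          C (x ^ 2 + c * x + (y ^ 2 + (c + d) * y) + c * (c + d)) * (P * X ^ 2) +
          C (c * (y ^ 2 + (c + d) * y) + (c + d) * (x ^ 2 + c * x)) * (P * X) +
          C ((x ^ 2 + c * x) * (y ^ 2 + (c + d) * y)) * P := by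
      simp only [C_add, C_mul, C_pow]
      linear_combination (P * C x * X * (X + C y) * (X + C y + C c + C d) +
        P * C y * X * (X ^ 2 + C c * X + C x ^ 2 + C c * C x) + P * C c * X ^ 3) * two0'
    rw [hexp, map_add s, map_add s, map_add s, map_add s, apply_C_mul, apply_C_mul, apply_C_mul,
      apply_C_mul]
    rw [v0, v2]
    have hcancel := div_mul_cancel₀ (s (P * X ^ 4) + d * s (P * X ^ 3)) h1
    linear_combination s (P * X) * heq - hcancel + d * (x ^ 2 + c * x) * s (P * X) * two0

theorem exists_card_eq_rootPoly {F : Type*} [Field F] [Fintype F] [DecidableEq F]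
    [CharP F 2] (hq : 16 ≤ Fintype.card F) (s : F[X] →ₗ[F] F) (t : F) (ht : t ≠ 0) (N : ℕ)
    (hN : 4 * N + 12 ≤ Fintype.card F) (hs : NonzeroUpTo s (N + 2)) :
    ∃ B : Finset F, B.card = N + 3 ∧ s (rootPoly B * (X + C (t + ∑ b ∈ B, b))) = 0 := by
  have two0 : (2 : F) = 0 := CharTwo.two_eq_zero
  by_cases h0 : NonzeroUpTo s N
  · obtain ⟨A, hA, h1, h2, h3⟩ :=
      exists_finset_nonzeroUpTo_twist s t ht N 0 (by omega) (by omega) h0 N le_rfl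
    subst hA
    refine exists_card_eq_rootPoly_of_pair_double s t A (by omega) h3 (Or.inl ?_) ?_
    · obtain ⟨j, hj, h⟩ := h1
      obtain rfl : j = 0 := by omega
      simpa [twist_apply] using h
    · intro a ha
      obtain ⟨j, hj, h⟩ := h2 a ha
      obtain rfl : j = 0 := by omega
      simpa [twist_apply] using h
  by_cases h1 : s (X ^ (N + 2)) + t * s (X ^ (N + 1)) = 0
  · refine exists_card_eq_rootPoly_of_degenerate hq s t ht N (by omega) h0 ?_ h1
    intro h
    rw [h, mul_zero, add_zero] at h1
    obtain ⟨j, hj, hsj⟩ := hs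
    rcases Nat.lt_or_ge N j with hNj | hNj
    · obtain rfl | rfl : j = N + 1 ∨ j = N + 2 := by omega
      · exact hsj h
      · exact hsj h1
    · exact h0 ⟨j, hNj, hsj⟩
  -- As `s` vanishes up to degree `N`, the sum `∑ A` cancels and the second alternative reduces to
  -- `s (X ^ (N + 2)) + t s (X ^ (N + 1)) ≠ 0`, whatever `A` is.
  · obtain ⟨A, hA, -, h2, h3⟩ :=
      exists_finset_nonzeroUpTo_twist s t ht N 2 le_rfl (by omega) hs N le_rfl
    subst hA
    refine exists_card_eq_rootPoly_of_pair_double s t A (by omega) h3 (Or.inr ?_) ?_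
    · obtain ⟨R, hR, hh⟩ := rootPoly_mul_X_sq A
      obtain ⟨R', hR', hh'⟩ := rootPoly_mul_X A
      rw [hh, hh']
      simp only [map_add, apply_C_mul, apply_eq_zero_of_not_nonzeroUpTo h0 hR,
        apply_eq_zero_of_not_nonzeroUpTo h0 hR']
      intro h
      apply h1
      linear_combination h - (∑ a ∈ A, a) * s (X ^ (A.card + 1)) * two0
    · intro a ha
      obtain ⟨j, hj, h⟩ := h2 a ha
      obtain rfl : j = 0 := by omega
      simpa [twist_apply] using h

/-! ### Power sums and parity checks -/

theorem sum_pow_eq_ite {F : Type*} [Field F] [Fintype F] (n : ℕ)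
    (hn : n < 2 * (Fintype.card F - 1)) :
    ∑ x : F, x ^ n = if n = Fintype.card F - 1 then -1 else 0 := by
  classical
  have hq : 1 < Fintype.card F := Fintype.one_lt_card
  rcases lt_trichotomy n (Fintype.card F - 1) with h | h | h
  · rw [if_neg h.ne, FiniteField.sum_pow_lt_card_sub_one _ _ h]
  · rw [if_pos h, h]
    have h1 : ∀ x : F, x ^ (Fintype.card F - 1) = 1 - if x = 0 then 1 else 0 := by
      intro x
      split_ifs with hx
      · rw [hx, zero_pow (by omega), sub_self]
      · rw [FiniteField.pow_card_sub_one_eq_one x hx, sub_zero]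
    simp [h1]
  · rw [if_neg h.ne']
    have h1 : ∀ x : F, x ^ n = x ^ (n - (Fintype.card F - 1)) := by
      intro x
      obtain ⟨j, hj⟩ : ∃ j, n = Fintype.card F + j := ⟨n - Fintype.card F, by omega⟩
      rw [show n - (Fintype.card F - 1) = j + 1 by omega, hj, pow_add, FiniteField.pow_card,
        pow_succ']
    simp only [h1]
    exact FiniteField.sum_pow_lt_card_sub_one _ _ (by omega)

/-- The pairing `∑ u_i p(α_i)` of a vector with a polynomial. -/
noncomputable def evalPairing {ι F : Type*} [Fintype ι] [Field F] (α : ι → F) (u : ι → F) :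
    F[X] →ₗ[F] F := ∑ i, u i • leval (α i)

theorem evalPairing_apply {ι F : Type*} [Fintype ι] [Field F] (α : ι → F) (u : ι → F)
    (p : F[X]) : evalPairing α u p = ∑ i, u i * p.eval (α i) := by
  simp [evalPairing]

theorem evalVec_apply {ι F : Type*} [Field F] (α : ι → F) (p : F[X]) (i : ι) :
    evalVec α p i = p.eval (α i) := rfl

theorem exists_natDegree_lt_evalVec {ι F : Type*} [Fintype ι] [Field F] (α : ι ≃ F) (u : ι → F)
    (h0 : 0 < Fintype.card ι) :
    ∃ g : F[X], g.natDegree < Fintype.card ι ∧ u = evalVec α g := by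
  classical
  have hinj : Set.InjOn α (Finset.univ : Finset ι) := α.injective.injOn
  refine ⟨Lagrange.interpolate Finset.univ α u, ?_, ?_⟩
  · have h := Lagrange.degree_interpolate_lt u hinj
    rw [Finset.card_univ] at h
    by_cases hz : Lagrange.interpolate Finset.univ α u = 0
    · rwa [hz, natDegree_zero]
    · exact (natDegree_lt_iff_degree_lt hz).2 h
  · ext i
    rw [evalVec_apply, Lagrange.eval_interpolate_at_node u hinj (Finset.mem_univ i)]

theorem evalPairing_evalVec_X_pow {ι F : Type*} [Fintype ι] [Field F] [Fintype F] (α : ι ≃ F)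
    (g : F[X]) (hg : g.natDegree < Fintype.card F) (i : ℕ) (hi : i + 1 < Fintype.card F) :
    evalPairing α (evalVec α g) (X ^ i) = -g.coeff (Fintype.card F - 1 - i) := by
  rw [evalPairing_apply]
  simp only [evalVec_apply, eval_pow, eval_X]
  rw [Equiv.sum_comp α fun x => g.eval x * x ^ i]
  simp only [eval_eq_sum_range' hg, Finset.sum_mul, mul_assoc, ← pow_add]
  rw [Finset.sum_comm]
  simp only [← Finset.mul_sum]
  rw [Finset.sum_eq_single (Fintype.card F - 1 - i)]
  · rw [sum_pow_eq_ite _ (by omega), if_pos (by omega), mul_neg_one]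
  · intro j hj hji
    rw [Finset.mem_range] at hj
    rw [sum_pow_eq_ite _ (by omega), if_neg (by omega), mul_zero]
  · intro h
    exact absurd (Finset.mem_range.2 (by omega)) h

theorem mem_twistedPolynomials_succ_iff {F : Type*} [Field F] (k : ℕ) (θ : F) (g : F[X]) :
    g ∈ twistedPolynomials (k + 1) θ ↔
      g.natDegree ≤ k + 1 ∧ g.coeff (k + 1) = θ * g.coeff k := by
  constructor
  · rintro ⟨c, rfl⟩
    simp only [Nat.add_sub_cancel]
    constructor
    · refine natDegree_add_le_of_degree_le (natDegree_sum_le_of_forall_le _ _ fun i hi => ?_) ?_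
      · rw [Finset.mem_range] at hi
        exact (natDegree_C_mul_X_pow_le _ _).trans (by omega)
      · compute_degree
    · have h : ∀ n, k ≤ n → (∑ i ∈ Finset.range k, C (c i) * X ^ i).coeff n = 0 := by
        intro n hn
        rw [finsetSum_coeff]
        refine Finset.sum_eq_zero fun i hi => ?_
        rw [Finset.mem_range] at hi
        rw [coeff_C_mul_X_pow, if_neg (by omega)]
      rw [coeff_add, coeff_add, h _ le_rfl, h _ (Nat.le_succ k)]
      simp only [coeff_C_mul, coeff_add, coeff_X_pow]
      simp [mul_comm]
  · rintro ⟨h1, h2⟩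
    refine ⟨g.coeff, ?_⟩
    simp only [Nat.add_sub_cancel]
    conv_lhs => rw [g.as_sum_range_C_mul_X_pow' (Nat.lt_succ_of_le h1)]
    rw [Finset.sum_range_succ, Finset.sum_range_succ, h2, C_mul]
    ring

theorem exists_add_mem_twistedPolynomials {F : Type*} [Field F] (k : ℕ) (θ : F) (g : F[X])
    (hg : g.natDegree ≤ k + 1) :
    ∃ a : F, ∃ f ∈ twistedPolynomials (k + 1) θ, g = C a * X ^ (k + 1) + f := by
  refine ⟨g.coeff (k + 1) - θ * g.coeff k,
    g - C (g.coeff (k + 1) - θ * g.coeff k) * X ^ (k + 1), ?_, by ring⟩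
  rw [mem_twistedPolynomials_succ_iff]
  constructor
  · exact (natDegree_sub_le_of_le hg (natDegree_C_mul_X_pow_le _ _)).trans (max_self _).le
  · rw [coeff_sub, coeff_sub, coeff_C_mul_X_pow, coeff_C_mul_X_pow, if_pos rfl,
      if_neg (by omega)]
    ring

theorem exists_evalVec_of_not_nonzeroUpTo {ι F : Type*} [Fintype ι] [Field F] [Fintype F]
    (α : ι ≃ F) (u : ι → F) (k N : ℕ) (hkN : k + N + 4 = Fintype.card F)
    (h : ¬ NonzeroUpTo (evalPairing α u) (N + 2)) :
    ∃ g : F[X], g.natDegree ≤ k ∧ u = evalVec α g := by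
  have hc := Fintype.card_congr α
  obtain ⟨g, hg, rfl⟩ := exists_natDegree_lt_evalVec α u (by omega)
  rw [hc] at hg
  refine ⟨g, natDegree_le_iff_coeff_eq_zero.2 fun j hj => ?_, rfl⟩
  by_cases hjq : j < Fintype.card F
  · have h1 := evalPairing_evalVec_X_pow α g hg (Fintype.card F - 1 - j) (by omega)
    rw [apply_eq_zero_of_not_nonzeroUpTo h (by rw [natDegree_X_pow]; omega),
      show Fintype.card F - 1 - (Fintype.card F - 1 - j) = j by omega] at h1
    exact neg_eq_zero.1 h1.symm
  · exact coeff_eq_zero_of_natDegree_lt (by omega)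

/-- The last check compares the coefficients of degrees `k` and `k + 1`, expressing the twist
relation. -/
theorem mem_TRS_of_evalPairing {ι F : Type*} [Fintype ι] [Field F] [Fintype F] [CharP F 2]
    (α : ι ≃ F) (u : ι → F) (k N : ℕ) (hk : 1 ≤ k) (hkN : k + 1 + N + 4 = Fintype.card F) (θ : F)
    (hθ : θ ≠ 0) (h : ¬ NonzeroUpTo (evalPairing α u) (N + 2))
    (h' : evalPairing α u (X ^ (N + 4) + C θ⁻¹ * X ^ (N + 3)) = 0) :
    u ∈ TRS α (k + 1) θ := by
  obtain ⟨g, hg, rfl⟩ := exists_evalVec_of_not_nonzeroUpTo α u (k + 1) N hkN h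
  refine ⟨g, (mem_twistedPolynomials_succ_iff k θ g).2 ⟨hg, ?_⟩, rfl⟩
  rw [map_add, apply_C_mul, evalPairing_evalVec_X_pow α g (by omega) _ (by omega),
    evalPairing_evalVec_X_pow α g (by omega) _ (by omega),
    show Fintype.card F - 1 - (N + 4) = k by omega,
    show Fintype.card F - 1 - (N + 3) = k + 1 by omega, CharTwo.neg_eq, CharTwo.neg_eq,
    CharTwo.add_eq_zero] at h'
  rw [h', mul_inv_cancel_left₀ hθ]

theorem natDegree_sub_rootPoly_mul_le {F : Type*} [Field F] [DecidableEq F] [CharP F 2]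
    (B : Finset F) (N : ℕ) (hB : B.card = N + 3) (t : F) :
    (rootPoly B * (X + C (t + ∑ b ∈ B, b)) - (X ^ (N + 4) + C t * X ^ (N + 3))).natDegree ≤
      N + 2 := by
  have two0' : (2 : F[X]) = 0 := CharTwo.two_eq_zero
  obtain ⟨R, hR, h⟩ := rootPoly_mul_X_sq B
  set e := ∑ b ∈ B, b with he
  set D := rootPoly B * (X + C (t + e)) - (X ^ (N + 4) + C t * X ^ (N + 3)) with hD
  by_cases hz : D = 0
  · simp [hz]
  -- The factor `X ^ 2` lets the two leading terms of `rootPoly B` be used without subtracting from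
  -- exponents.
  have h1 : X ^ 2 * D = (X + C (t + e)) * R + C ((t + e) * e) * X ^ (N + 4) := by
    rw [hB] at h
    simp only [hD, C_add, C_mul]
    linear_combination (X + C t + C e) * h + X ^ (N + 5) * C e * two0'
  have h2 : (X ^ 2 * D).natDegree ≤ N + 4 := by
    rw [h1]
    refine natDegree_add_le_of_degree_le ?_ (natDegree_C_mul_X_pow_le _ _)
    refine natDegree_mul_le.trans ?_
    rw [natDegree_X_add_C]
    omega
  rw [natDegree_X_pow_mul 2 hz] at h2
  omega

theorem eval_rootPoly_of_mem {F : Type*} [Field F] [CharP F 2] {B : Finset F} {b : F}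
    (hb : b ∈ B) : (rootPoly B).eval b = 0 := by
  rw [rootPoly, eval_prod]
  exact Finset.prod_eq_zero hb (by simp [CharTwo.add_self_eq_zero])

theorem errorDist_le_hammingDist {ι F : Type*} [Fintype ι] [DecidableEq F] [Field F]
    {C : Submodule F (ι → F)} (u : ι → F) {c : ι → F} (hc : c ∈ C) :
    errorDist C u ≤ hammingDist u c :=
  Nat.sInf_le ⟨c, hc, rfl⟩

theorem errorDist_le_of_nonzeroUpTo {ι F : Type*} [Fintype ι] [Field F] [Fintype F]
    [DecidableEq F] [CharP F 2]
    (α : ι ≃ F) (u : ι → F) (k N : ℕ) (hkN : k + 1 + N + 4 = Fintype.card F) (θ : F)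
    (hθ : θ ≠ 0) (hq : 16 ≤ Fintype.card F) (hN : 4 * N + 12 ≤ Fintype.card F)
    (h : NonzeroUpTo (evalPairing α u) (N + 2)) :
    errorDist (TRS α (k + 1) θ) u ≤ N + 3 := by
  classical
  obtain ⟨B, hB, hQ⟩ := exists_card_eq_rootPoly hq (evalPairing α u) θ⁻¹ (inv_ne_zero hθ) N hN h
  -- Interpolation weights: the error on `B` that reproduces `s` on all polynomials of degree below
  -- `B.card = N + 3`.
  let v : F → F := fun b => if b ∈ B then evalPairing α u (Lagrange.basis B id b) else 0
  let e : ι → F := fun i => v (α i)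
  have he : ∀ p : F[X], evalPairing α e p =
      ∑ b ∈ B, evalPairing α u (Lagrange.basis B id b) * p.eval b := by
    intro p
    rw [evalPairing_apply, Equiv.sum_comp α fun b => v b * p.eval b]
    simp only [v, ite_mul, zero_mul, Finset.sum_ite_mem, Finset.univ_inter]
  have hlow : ∀ p : F[X], p.natDegree ≤ N + 2 → evalPairing α e p = evalPairing α u p := by
    intro p hp
    have hdeg : p.degree < B.card := by
      rw [hB]
      exact lt_of_le_of_lt (natDegree_le_iff_degree_le.1 hp) (by exact_mod_cast Nat.lt_succ_self _)
    conv_rhs => rw [Lagrange.eq_interpolate (v := id) Function.injective_id.injOn hdeg,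
      Lagrange.interpolate_apply, map_sum]
    rw [he]
    refine Finset.sum_congr rfl fun b _ => ?_
    rw [apply_C_mul, mul_comm, id]
  have hsub : ∀ p, evalPairing α (u - e) p = evalPairing α u p - evalPairing α e p := by
    intro p
    simp only [evalPairing_apply, Pi.sub_apply, sub_mul, Finset.sum_sub_distrib]
  have hmem : u - e ∈ TRS α (k + 1) θ := by
    refine mem_TRS_of_evalPairing α (u - e) k N (by omega) hkN θ hθ ?_ ?_
    · rintro ⟨j, hj, hne⟩
      apply hne
      rw [hsub, hlow _ (by rwa [natDegree_X_pow]), sub_self]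
    · have hD := hlow _ (natDegree_sub_rootPoly_mul_le B N hB θ⁻¹)
      have hQe : evalPairing α e (rootPoly B * (X + C (θ⁻¹ + ∑ b ∈ B, b))) = 0 := by
        rw [he]
        refine Finset.sum_eq_zero fun b hb => ?_
        rw [eval_mul, eval_rootPoly_of_mem hb, zero_mul, mul_zero]
      rw [map_sub, map_sub, hQ, hQe] at hD
      rw [hsub]
      linear_combination hD
  refine (errorDist_le_hammingDist u hmem).trans ?_
  rw [← hB, ← Finset.card_map α.symm.toEmbedding]
  refine Finset.card_le_card fun i hi => ?_
  have hi' : u i ≠ u i - e i := by simpa using hi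
  have hiB : α i ∈ B := by
    by_contra hn
    apply hi'
    simp [e, v, hn]
  exact Finset.mem_map.2 ⟨α i, hiB, by simp⟩

/-! ### Error distances and the dichotomy -/

theorem exists_errorDist_eq {ι F : Type*} [Fintype ι] [DecidableEq F] [Field F]
    (C : Submodule F (ι → F)) (u : ι → F) : ∃ c ∈ C, errorDist C u = hammingDist u c :=
  Nat.sInf_mem (s := {d | ∃ c ∈ C, d = hammingDist u c}) ⟨_, 0, C.zero_mem, rfl⟩

theorem errorDist_smul_add_le {ι F : Type*} [Fintype ι] [DecidableEq F] [Field F]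
    (C : Submodule F (ι → F)) (u c : ι → F) (a : F) (hc : c ∈ C) :
    errorDist C (a • u + c) ≤ errorDist C u := by
  obtain ⟨c', hc', h⟩ := exists_errorDist_eq C u
  refine (errorDist_le_hammingDist _ (C.add_mem (C.smul_mem a hc') hc)).trans ?_
  rw [h]
  refine Finset.card_le_card fun i hi => ?_
  simp only [Finset.mem_filter, Finset.mem_univ, true_and, Pi.add_apply, Pi.smul_apply] at hi ⊢
  intro h'
  exact hi (by rw [h'])

theorem errorDist_smul_add {ι F : Type*} [Fintype ι] [DecidableEq F] [Field F]
    (C : Submodule F (ι → F)) (u c : ι → F) (a : F) (ha : a ≠ 0) (hc : c ∈ C) :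
    errorDist C (a • u + c) = errorDist C u := by
  refine le_antisymm (errorDist_smul_add_le C u c a hc) ?_
  have h := errorDist_smul_add_le C (a • u + c) (-(a⁻¹ • c)) a⁻¹ (C.neg_mem (C.smul_mem _ hc))
  rwa [smul_add, inv_smul_smul₀ ha, add_neg_cancel_right] at h

theorem le_errorDist_X_pow {ι F : Type*} [Fintype ι] [Field F] [Fintype F] [DecidableEq F]
    (α : ι ≃ F) (k N : ℕ) (hkN : k + 1 + N + 4 = Fintype.card F) (θ : F) :
    N + 4 ≤ errorDist (TRS α (k + 1) θ) (evalVec α (X ^ (k + 1))) := by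
  classical
  obtain ⟨_, ⟨f, hf, rfl⟩, h⟩ := exists_errorDist_eq (TRS α (k + 1) θ) (evalVec α (X ^ (k + 1)))
  rw [h]
  replace hf := (mem_twistedPolynomials_succ_iff k θ f).1 hf
  set p : F[X] := X ^ (k + 1) - f with hp
  have hp0 : p ≠ 0 := by
    intro h0
    rw [hp, sub_eq_zero] at h0
    have h1 := hf.2
    rw [← h0, coeff_X_pow, coeff_X_pow, if_pos rfl, if_neg (by omega), mul_zero] at h1
    exact one_ne_zero h1
  have hpd : p.natDegree ≤ k + 1 :=
    (natDegree_sub_le_of_le (natDegree_X_pow_le _) hf.1).trans (max_self _).le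
  have h1 := card_filter_eval_eq_zero_le p hp0 _ hpd
  have h2 : (Finset.univ.filter fun x => ¬ p.eval x = 0).card ≤
      hammingDist (evalVec α (X ^ (k + 1))) (evalVec α f) := by
    rw [← Finset.card_map α.symm.toEmbedding]
    refine Finset.card_le_card fun i hi => ?_
    obtain ⟨x, hx, rfl⟩ := Finset.mem_map.1 hi
    simp only [Finset.mem_filter, Finset.mem_univ, true_and] at hx ⊢
    intro h'
    apply hx
    simp only [evalVec_apply, Equiv.coe_toEmbedding, Equiv.apply_symm_apply] at h'
    rw [hp, eval_sub, h', sub_self]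
  have h3 := Finset.card_filter_add_card_filter_not (s := (Finset.univ : Finset F))
    (fun x => p.eval x = 0)
  rw [Finset.card_univ] at h3
  change _ ≤ hammingDist (evalVec α (X ^ (k + 1))) (evalVec α f)
  omega

theorem errorDist_le_or_exists {ι F : Type*} [Fintype ι] [Field F] [Fintype F]
    [DecidableEq F] [CharP F 2]
    (α : ι ≃ F) (u : ι → F) (k N : ℕ) (hkN : k + 1 + N + 4 = Fintype.card F) (θ : F)
    (hθ : θ ≠ 0) (hq : 16 ≤ Fintype.card F) (hN : 4 * N + 12 ≤ Fintype.card F) :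
    errorDist (TRS α (k + 1) θ) u ≤ N + 3 ∨ ∃ a : F, a ≠ 0 ∧
      ∃ f ∈ twistedPolynomials (k + 1) θ, u = evalVec α (C a * X ^ (k + 1) + f) := by
  by_cases h : NonzeroUpTo (evalPairing α u) (N + 2)
  · exact Or.inl (errorDist_le_of_nonzeroUpTo α u k N hkN θ hθ hq hN h)
  obtain ⟨g, hg, rfl⟩ := exists_evalVec_of_not_nonzeroUpTo α u (k + 1) N hkN h
  obtain ⟨a, f, hf, rfl⟩ := exists_add_mem_twistedPolynomials k θ g hg
  by_cases ha : a = 0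
  · left
    refine (errorDist_le_hammingDist _ (Submodule.mem_map_of_mem hf)).trans ?_
    simp [ha]
  · exact Or.inr ⟨a, ha, f, hf, rfl⟩

theorem theorem4 {F : Type*} [Field F] [Fintype F] [DecidableEq F]
    (q m : ℕ) (hqm : q = 2 ^ m) (hq : 8 ≤ q) (hF : Fintype.card F = q)
    (α : Fin q ≃ F) (θ : F) (hθ : θ ≠ 0) (k : ℕ)
    (hk₁ : (3 * (q : ℚ) - 4) / 4 ≤ (k : ℚ)) (hk₂ : (k : ℚ) ≤ (q : ℚ) - 4)
    (u : Fin q → F) :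
    IsDeepHole (TRS α k θ) u ↔
      ∃ a : F, a ≠ 0 ∧ ∃ f ∈ twistedPolynomials k θ, u = evalVec α (C a * X ^ k + f) := by
  have hk₁' : 3 * q ≤ 4 * k + 4 := by
    have : (3 * q : ℚ) ≤ 4 * k + 4 := by linarith
    exact_mod_cast this
  have hk₂' : k + 4 ≤ q := by
    have : (k + 4 : ℚ) ≤ q := by linarith
    exact_mod_cast this
  -- For `q = 8` the bounds would demand `5 ≤ k ≤ 4`.
  have hm : 4 ≤ m := by
    by_contra! hm
    have : 2 ^ m ≤ 2 ^ 3 := Nat.pow_le_pow_right (by norm_num) (by omega)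
    omega
  have hq16 : 16 ≤ Fintype.card F := by
    rw [hF, hqm]
    exact Nat.pow_le_pow_right (n := 2) (by norm_num) hm
  have : Fact (Nat.Prime 2) := ⟨Nat.prime_two⟩
  have : CharP F 2 := charP_of_card_eq_prime_pow (hF.trans hqm)
  obtain ⟨k, rfl⟩ : ∃ j, k = j + 1 := ⟨k - 1, by omega⟩
  obtain ⟨N, hN⟩ : ∃ N, k + 1 + N + 4 = Fintype.card F := ⟨q - (k + 1) - 4, by omega⟩
  have hN' : 4 * N + 12 ≤ Fintype.card F := by omega
  have hlow := le_errorDist_X_pow α k N hN θ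
  have hdich := fun w => errorDist_le_or_exists α w k N hN θ hθ hq16 hN'
  have hcoset : ∀ w : Fin q → F, (∃ a : F, a ≠ 0 ∧ ∃ f ∈ twistedPolynomials (k + 1) θ,
      w = evalVec α (C a * X ^ (k + 1) + f)) →
      errorDist (TRS α (k + 1) θ) w =
        errorDist (TRS α (k + 1) θ) (evalVec α (X ^ (k + 1))) := by
    rintro _ ⟨a, ha, f, hf, rfl⟩
    rw [map_add, ← smul_eq_C_mul, map_smul]
    exact errorDist_smul_add _ _ _ a ha ⟨f, hf, rfl⟩
  obtain ⟨⟨w, hw⟩, hmax⟩ := isGreatest_coveringRadius (TRS α (k + 1) θ)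
  have hge := hmax ⟨evalVec α (X ^ (k + 1)), rfl⟩
  constructor
  · intro hu
    refine (hdich u).resolve_left fun hle => ?_
    rw [IsDeepHole] at hu
    omega
  · intro hu
    have hwK := (hdich w).resolve_left (by omega)
    rw [IsDeepHole, hcoset u hu, ← hw, hcoset w hwK]
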